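/- Let $a,b$ be real numbers of opposite signs and let $q\in\mathbb{C}$ with $0<|q|<1$. Put $$c=-\frac{1-ab}{2\sqrt{-ab}},\qquad \alpha_k=c\,q^{2k},\qquad \beta_k=\tfrac14\Big(1-\frac{bq^{2k-1}}{a}\Big)\Big(1-\frac{aq^{2k-1}}{b}\Big).$$ Let $P_k$ and $P_k^*$ be the polynomials which both satisfy $$x\,y_k(x)=y_{k+1}(x)+\alpha_k\,y_k(x)+\beta_k\,y_{k-1}(x)\qquad(k>0),$$ with $P_0=1$, $P_1=x-c$ and $P_0^*=0$, $P_1^*=1$. Write $(A;p)_k=\prod_{j=0}^{k-1}(1-Ap^j)$ and $${}_2\phi_1(A,B;C;p,z)=\sum_{k\ge0}\frac{(A;p)_k(B;p)_k}{(p;p)_k(C;p)_k}z^k .$$ Let $\gamma_1,\gamma_2=\frac{aq}{2b}\big(c\pm\sqrt{c^2-1}\big)$ and $$F(\rho)={}_2\phi_1\big(2\gamma_1\rho,2\gamma_2\rho;q^2\rho^2;q^2,\tfrac{bq}{a}\big),\qquad G(\rho)=\Big(1-\frac{b}{aq}\Big)\,{}_2\phi_1\big(2\gamma_1\rho,2\gamma_2\rho;q^2\rho^2;q^2,\tfrac{b}{aq}\big).$$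 For complex $x\notin(-1,1)$ write $x=\cos\vartheta$. If $\Im x>0$, or $x$ is real and $x>1$, choose $\vartheta$ with $|e^{-i\vartheta}|<|e^{i\vartheta}|$ and put $\rho=e^{-i\vartheta}$. If $\Im x<0$, or $x$ is real and $x<-1$, choose $\vartheta$ with $|e^{i\vartheta}|<|e^{-i\vartheta}|$ and put $\rho=e^{i\vartheta}$. If $x=\pm1$, put $\rho=\pm1$. Then there is a finite set $S\subset\mathbb{C}$ (depending only on $a,b,q$) such that for every complex $x\notin(-1,1)$ with $x\notin S$: 1. $P_k(x)\ne0$ for all large $k$, and the limit $X(x)=\lim_{k\to\infty}P_k^*(x)/P_k(x)$ exists in $\mathbb{C}$; 2. if moreover $|b/(aq)|<1$ (so that the series defining $F$ and $G$ have arguments inside the unit disc), then both series converge at $\rho$, $G(\rho)\neq0$, and $$X(x)=2\rho\,\frac{F(\rho)}{G(\rho)}.$$ -/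

import Mathlib

open Filter Topology

/-- The finite `p`-shifted factorial `(A; p)_n = (1 - A)(1 - A p) ⋯ (1 - A p ^ (n - 1))`. -/
noncomputable def qPoch (A p : ℂ) (n : ℕ) : ℂ :=
  ∏ j ∈ Finset.range n, (1 - A * p ^ j)

/-- The `k`-th term of the basic hypergeometric series `₂φ₁ (A, B; C; p, z)`. -/
noncomputable def phi21Term (A B C p z : ℂ) (k : ℕ) : ℂ :=
  qPoch A p k * qPoch B p k / (qPoch p p k * qPoch C p k) * z ^ k

/-- The basic hypergeometric series `₂φ₁ (A, B; C; p, z)` with base `p`. -/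
noncomputable def phi21 (A B C p z : ℂ) : ℂ :=
  ∑' k : ℕ, phi21Term A B C p z k

/-- The constant `c = -(1 - ab) / (2 √(-ab))` (real, since `a` and `b` have opposite signs). -/
noncomputable def cConst (a b : ℝ) : ℝ :=
  -(1 - a * b) / (2 * Real.sqrt (-(a * b)))

/-- The recurrence coefficient `α_k = c q ^ (2k)`. -/
noncomputable def alphaCoeff (a b : ℝ) (q : ℂ) (k : ℕ) : ℂ :=
  (cConst a b : ℂ) * q ^ (2 * k)

/-- The recurrence coefficient `β_k = (1/4) (1 - b q ^ (2k-1) / a) (1 - a q ^ (2k-1) / b)`. -/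
noncomputable def betaCoeff (a b : ℝ) (q : ℂ) (k : ℕ) : ℂ :=
  (1 / 4 : ℂ) * (1 - (b : ℂ) * q ^ (2 * (k : ℤ) - 1) / (a : ℂ)) *
    (1 - (a : ℂ) * q ^ (2 * (k : ℤ) - 1) / (b : ℂ))

/-- The polynomials `P_k`: `P_0 = 1`, `P_1 = x - c`, and
`x P_k = P_{k+1} + α_k P_k + β_k P_{k-1}` for `k > 0`. -/
noncomputable def denomPoly (a b : ℝ) (q : ℂ) : ℕ → Polynomial ℂ
  | 0 => 1
  | 1 => Polynomial.X - Polynomial.C (cConst a b : ℂ)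
  | (k + 2) =>
      (Polynomial.X - Polynomial.C (alphaCoeff a b q (k + 1))) * denomPoly a b q (k + 1) -
        Polynomial.C (betaCoeff a b q (k + 1)) * denomPoly a b q k

/-- The associated (numerator) polynomials `P*_k`: `P*_0 = 0`, `P*_1 = 1`, and the same
recurrence relation as for `P_k`. -/
noncomputable def numerPoly (a b : ℝ) (q : ℂ) : ℕ → Polynomial ℂ
  | 0 => 0
  | 1 => 1
  | (k + 2) =>
      (Polynomial.X - Polynomial.C (alphaCoeff a b q (k + 1))) * numerPoly a b q (k + 1) -
        Polynomial.C (betaCoeff a b q (k + 1)) * numerPoly a b q k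

/-- The `k`-th convergent `P*_k(x) / P_k(x)` of the continued fraction. -/
noncomputable def convergent (a b : ℝ) (q x : ℂ) (k : ℕ) : ℂ :=
  (numerPoly a b q k).eval x / (denomPoly a b q k).eval x

/-- `γ₁ = (aq / 2b) (c + √(c² - 1))`; here `c² - 1 = (1 + ab)² / (-4ab) ≥ 0`. -/
noncomputable def gammaOne (a b : ℝ) (q : ℂ) : ℂ :=
  (a : ℂ) * q / (2 * (b : ℂ)) * ((cConst a b + Real.sqrt (cConst a b ^ 2 - 1) : ℝ) : ℂ)

/-- `γ₂ = (aq / 2b) (c - √(c² - 1))`. -/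
noncomputable def gammaTwo (a b : ℝ) (q : ℂ) : ℂ :=
  (a : ℂ) * q / (2 * (b : ℂ)) * ((cConst a b - Real.sqrt (cConst a b ^ 2 - 1) : ℝ) : ℂ)

/-- The `k`-th term of `₂φ₁ (2γ₁ρ, 2γ₂ρ; q²ρ²; q², z)`. -/
noncomputable def seriesTerm (a b : ℝ) (q ρ z : ℂ) (k : ℕ) : ℂ :=
  phi21Term (2 * gammaOne a b q * ρ) (2 * gammaTwo a b q * ρ) (q ^ 2 * ρ ^ 2) (q ^ 2) z k

/-- `F(ρ) = ₂φ₁ (2γ₁ρ, 2γ₂ρ; q²ρ²; q², bq/a)`. -/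
noncomputable def FSeries (a b : ℝ) (q ρ : ℂ) : ℂ :=
  phi21 (2 * gammaOne a b q * ρ) (2 * gammaTwo a b q * ρ) (q ^ 2 * ρ ^ 2) (q ^ 2)
    ((b : ℂ) * q / (a : ℂ))

/-- `G(ρ) = (1 - b/(aq)) ₂φ₁ (2γ₁ρ, 2γ₂ρ; q²ρ²; q², b/(aq))`. -/
noncomputable def GSeries (a b : ℝ) (q ρ : ℂ) : ℂ :=
  (1 - (b : ℂ) / ((a : ℂ) * q)) *
    phi21 (2 * gammaOne a b q * ρ) (2 * gammaTwo a b q * ρ) (q ^ 2 * ρ ^ 2) (q ^ 2)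
      ((b : ℂ) / ((a : ℂ) * q))

/-- `x` lies in the open upper half plane, or `x` is real and `x > 1`. -/
def IsUpper (x : ℂ) : Prop := 0 < x.im ∨ (x.im = 0 ∧ 1 < x.re)

/-- `x` lies in the open lower half plane, or `x` is real and `x < -1`. -/
def IsLower (x : ℂ) : Prop := x.im < 0 ∨ (x.im = 0 ∧ x.re < -1)

/-- `ϑ` is an angle for `x`: `x = cos ϑ`, where the sign of `ϑ` (that is, the branch of
`√(x² - 1)` in `e^{± i ϑ} = x ± √(x² - 1)`) is chosen so that `|e^{-iϑ}| < |e^{iϑ}|` on the upper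
side and `|e^{iϑ}| < |e^{-iϑ}|` on the lower side. -/
def IsAngle (x ϑ : ℂ) : Prop :=
  Complex.cos ϑ = x ∧
  (IsUpper x → ‖Complex.exp (-(Complex.I * ϑ))‖ < ‖Complex.exp (Complex.I * ϑ)‖) ∧
  (IsLower x → ‖Complex.exp (Complex.I * ϑ)‖ < ‖Complex.exp (-(Complex.I * ϑ))‖)

open Classical in
/-- The number `ρ`: it is `ρ₁ = e^{-iϑ}` on the upper side, `ρ₂ = e^{iϑ}` on the lower side,
`1` at `x = 1` and `-1` at `x = -1` (it is not used for `x` in `(-1, 1)`). -/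
noncomputable def rho (x ϑ : ℂ) : ℂ :=
  if IsUpper x then Complex.exp (-(Complex.I * ϑ))
  else if IsLower x then Complex.exp (Complex.I * ϑ)
  else if x = 1 then 1
  else -1

/-- The open interval `(-1, 1)` of the real line, as a subset of `ℂ`. -/
def cutInterval : Set ℂ := {x : ℂ | x.im = 0 ∧ -1 < x.re ∧ x.re < 1}

/-! Write `x = (ρ + ρ⁻¹) / 2` with `|ρ| < 1` or `ρ = ±1`. Scaling by `(2ρ)^k` turns the recurrence
into one with limiting roots `1` and `ρ²`. The `q`-difference equation of `₂φ₁`, sampled at `z = b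
q^(2k-1) / a`, provides a minimal solution built from values `f_k → 1` (`phi21_qDifference`,
`phiShift_recurrence`).

The Casoratian of any solution with it is a constant times a product converging to a nonzero limit
(`casoratian_add`). Dividing by `f` and by a second convergent product leaves a first-order
recurrence with ratio `ρ²`. If the constants are `C ≠ 0` for `P` and `C'` for `P*`, then `P*_k -
(C'/C) P_k` is negligible against `P_k`, so `P*_k / P_k → C'/C` (`tendsto_div_of_casoratian`).
Started at index `0`, the constants are `C = G(ρ)` and `C' = 2ρF(ρ)`; when `|b/(aq)| ≥ 1` a later
index `N` is used.

The exceptional `x` come from zeros of `C` in `|ρ| ≤ 1`. As `C` is analytic on a larger disc and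
nonzero at `ρ = 0`, they are finitely many (`finite_zeros_casoratian`). -/

/-! ### Convergence, regularity and `q`-difference equation of `₂φ₁`. -/

lemma phi21Term_zero (A B C p z : ℂ) : phi21Term A B C p z 0 = 1 := by
  simp [phi21Term, qPoch]

lemma phi21Term_succ (A B C p z : ℂ) (k : ℕ) :
    phi21Term A B C p z (k + 1) =
      (1 - A * p ^ k) * (1 - B * p ^ k) / ((1 - p * p ^ k) * (1 - C * p ^ k)) * z *
        phi21Term A B C p z k := by
  simp only [phi21Term, qPoch, Finset.prod_range_succ, div_eq_mul_inv, mul_inv]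
  ring

lemma phi21Term_mul_pow (A B C p z w : ℂ) (k : ℕ) :
    phi21Term A B C p (w * z) k = w ^ k * phi21Term A B C p z k := by
  simp only [phi21Term, mul_pow]
  ring

/-- A majorant, uniform over `‖ρ‖ ≤ R` and `‖z‖ ≤ r`, of the terms of
`₂φ₁ (αρ, βρ; pρ²; p, z)`; here `s = ‖α‖`, `t = ‖β‖` and `P = ‖p‖`. -/
noncomputable def phiMajorant (s t P R r : ℝ) (k : ℕ) : ℝ :=
  ∏ j ∈ Finset.range k,
    ((1 + s * R * P ^ j) * (1 + t * R * P ^ j) / ((1 - P * P ^ j) * (1 - P * R ^ 2 * P ^ j)) * r)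

lemma summable_phiMajorant (s t : ℝ) {P : ℝ} (R : ℝ) {r : ℝ} (hP0 : 0 ≤ P) (hP1 : P < 1)
    (hr0 : 0 ≤ r) (hr1 : r < 1) : Summable (phiMajorant s t P R r) := by
  obtain ⟨r', hr', hr'1⟩ := exists_between hr1
  have hpow : Tendsto (fun j : ℕ => P ^ j) atTop (𝓝 0) :=
    tendsto_pow_atTop_nhds_zero_of_lt_one hP0 hP1
  have hlim : Tendsto (fun j : ℕ => (1 + s * R * P ^ j) * (1 + t * R * P ^ j) /
      ((1 - P * P ^ j) * (1 - P * R ^ 2 * P ^ j)) * r) atTop (𝓝 r) := by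
    have h (c : ℝ) : Tendsto (fun j : ℕ => c * P ^ j) atTop (𝓝 0) := by
      simpa using hpow.const_mul c
    have := ((((h (s * R)).const_add 1).mul ((h (t * R)).const_add 1)).div
      (((h P).const_sub 1).mul ((h (P * R ^ 2)).const_sub 1)) (by norm_num)).mul_const r
    simpa using this
  refine summable_of_ratio_norm_eventually_le hr'1 ?_
  have habs := hlim.norm
  rw [Real.norm_of_nonneg hr0] at habs
  filter_upwards [habs.eventually_le_const hr'] with n hn
  rw [phiMajorant, Finset.prod_range_succ, norm_mul, mul_comm]
  exact mul_le_mul_of_nonneg_right hn (norm_nonneg _)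

lemma mul_pow_lt_one {x P : ℝ} (hx0 : 0 ≤ x) (hx : x < 1) (hP0 : 0 ≤ P) (hP1 : P < 1) (k : ℕ) :
    x * P ^ k < 1 :=
  (mul_le_of_le_one_right hx0 (pow_le_one₀ hP0 hP1.le)).trans_lt hx

lemma one_sub_mul_pow_ne_zero {x p : ℂ} (hx : ‖x‖ < 1) (hp : ‖p‖ < 1) (k : ℕ) :
    1 - x * p ^ k ≠ 0 := by
  intro h
  have := mul_pow_lt_one (norm_nonneg _) hx (norm_nonneg _) hp k
  rw [← norm_pow, ← norm_mul, ← sub_eq_zero.1 h, norm_one] at this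
  exact lt_irrefl _ this

lemma norm_phi21Term_le {α β p ρ z : ℂ} {R r : ℝ} (hp : ‖p‖ < 1) (hR : ‖p‖ * R ^ 2 < 1)
    (hρ : ‖ρ‖ ≤ R) (hz : ‖z‖ ≤ r) (k : ℕ) :
    ‖phi21Term (α * ρ) (β * ρ) (p * ρ ^ 2) p z k‖ ≤ phiMajorant ‖α‖ ‖β‖ ‖p‖ R r k := by
  have hR0 : 0 ≤ R := (norm_nonneg _).trans hρ
  have hr0 : 0 ≤ r := (norm_nonneg _).trans hz
  induction k with
  | zero => simp [phi21Term_zero, phiMajorant]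
  | succ k ih =>
    rw [phi21Term_succ, phiMajorant, Finset.prod_range_succ, mul_comm, norm_mul]
    rw [phiMajorant] at ih
    have hnum (γ : ℂ) : ‖1 - γ * ρ * p ^ k‖ ≤ 1 + ‖γ‖ * R * ‖p‖ ^ k := by
      refine (norm_sub_le _ _).trans ?_
      rw [norm_one, norm_mul, norm_mul, norm_pow]
      gcongr
    have h1 : 0 < 1 - ‖p‖ * ‖p‖ ^ k :=
      sub_pos.2 (mul_pow_lt_one (norm_nonneg _) hp (norm_nonneg _) hp k)
    have h2 : 0 < 1 - ‖p‖ * R ^ 2 * ‖p‖ ^ k :=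
      sub_pos.2 (mul_pow_lt_one (by positivity) hR (norm_nonneg _) hp k)
    have hd1 : 1 - ‖p‖ * ‖p‖ ^ k ≤ ‖1 - p * p ^ k‖ := by
      have := norm_sub_norm_le (1 : ℂ) (p * p ^ k)
      rwa [norm_one, norm_mul, norm_pow] at this
    have hd2 : 1 - ‖p‖ * R ^ 2 * ‖p‖ ^ k ≤ ‖1 - p * ρ ^ 2 * p ^ k‖ := by
      have := norm_sub_norm_le (1 : ℂ) (p * ρ ^ 2 * p ^ k)
      rw [norm_one, norm_mul, norm_mul, norm_pow, norm_pow] at this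
      refine le_trans ?_ this
      gcongr
    refine mul_le_mul ih ?_ (norm_nonneg _) ((norm_nonneg _).trans ih)
    rw [norm_mul, norm_div, norm_mul, norm_mul]
    have := hnum α
    have := hnum β
    gcongr

lemma summable_phi21Term {α β p ρ z : ℂ} (hp : ‖p‖ < 1) (hρ : ‖p‖ * ‖ρ‖ ^ 2 < 1) (hz : ‖z‖ < 1) :
    Summable (phi21Term (α * ρ) (β * ρ) (p * ρ ^ 2) p z) :=
  Summable.of_norm_bounded
    (summable_phiMajorant ‖α‖ ‖β‖ ‖ρ‖ (norm_nonneg _) hp (norm_nonneg _) hz)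
    (norm_phi21Term_le hp hρ le_rfl le_rfl)

lemma differentiableOn_phi21 {α β p z : ℂ} {R : ℝ} (hp : ‖p‖ < 1) (hR : ‖p‖ * R ^ 2 < 1)
    (hz : ‖z‖ < 1) :
    DifferentiableOn ℂ (fun ρ => phi21 (α * ρ) (β * ρ) (p * ρ ^ 2) p z) (Metric.ball 0 R) := by
  refine Complex.differentiableOn_tsum_of_summable_norm
    (summable_phiMajorant ‖α‖ ‖β‖ R (norm_nonneg _) hp (norm_nonneg _) hz) ?_ Metric.isOpen_ball
    fun k ρ hρ => norm_phi21Term_le hp hR (mem_ball_zero_iff.1 hρ).le le_rfl k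
  intro k
  unfold phi21Term qPoch
  refine DifferentiableOn.mul (DifferentiableOn.div (by fun_prop) (by fun_prop) ?_) (by fun_prop)
  intro ρ hρ
  refine mul_ne_zero (Finset.prod_ne_zero_iff.2 fun j _ => one_sub_mul_pow_ne_zero hp hp j)
    (Finset.prod_ne_zero_iff.2 fun j _ => one_sub_mul_pow_ne_zero ?_ hp j)
  rw [norm_mul, norm_pow]
  refine lt_of_le_of_lt ?_ hR
  have := (mem_ball_zero_iff.1 hρ).le
  gcongr

lemma tendsto_phi21_one {α β p ρ : ℂ} (hp : ‖p‖ < 1) (hρ : ‖p‖ * ‖ρ‖ ^ 2 < 1) {z : ℕ → ℂ}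
    (hz : Tendsto z atTop (𝓝 0)) :
    Tendsto (fun k => phi21 (α * ρ) (β * ρ) (p * ρ ^ 2) p (z k)) atTop (𝓝 1) := by
  have hsum : ∑' n : ℕ, (if n = 0 then (1 : ℂ) else 0) = 1 := by
    rw [tsum_ite_eq]
  rw [← hsum]
  refine tendsto_tsum_of_dominated_convergence
    (summable_phiMajorant ‖α‖ ‖β‖ ‖ρ‖ (norm_nonneg _) hp (by norm_num : (0 : ℝ) ≤ 1 / 2)
      (by norm_num)) ?_ ?_
  · intro n
    rcases n with _ | n
    · simp [phi21Term_zero]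
    · have := (hz.pow (n + 1)).const_mul (qPoch (α * ρ) p (n + 1) * qPoch (β * ρ) p (n + 1) /
        (qPoch p p (n + 1) * qPoch (p * ρ ^ 2) p (n + 1)))
      simpa [phi21Term] using this
  · have h0 : Tendsto (fun k => ‖z k‖) atTop (𝓝 0) := by simpa using hz.norm
    filter_upwards [h0.eventually_le_const (by norm_num : (0 : ℝ) < 1 / 2)] with k hk
    exact norm_phi21Term_le hp hρ le_rfl hk

/-- The second order `q`-difference equation of `₂φ₁ (A, B; pr; p, z)` in the variable `z`. -/
lemma phi21_qDifference {α β p ρ z : ℂ} (hp : ‖p‖ < 1) (hρ : ‖p‖ * ‖ρ‖ ^ 2 < 1) (hz : ‖z‖ < 1) :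
    (1 - z) * phi21 (α * ρ) (β * ρ) (p * ρ ^ 2) p z =
      (1 + ρ ^ 2 - (α * ρ + β * ρ) * z) * phi21 (α * ρ) (β * ρ) (p * ρ ^ 2) p (p * z) -
      (ρ ^ 2 - α * ρ * (β * ρ) * z) * phi21 (α * ρ) (β * ρ) (p * ρ ^ 2) p (p * (p * z)) := by
  have hpz : ‖p * z‖ < 1 := by
    rw [norm_mul]; exact mul_lt_one_of_nonneg_of_lt_one_left (norm_nonneg _) hp hz.le
  have hppz : ‖p * (p * z)‖ < 1 := by
    rw [norm_mul]; exact mul_lt_one_of_nonneg_of_lt_one_left (norm_nonneg _) hp hpz.le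
  have hρ' : ‖p * ρ ^ 2‖ < 1 := by rwa [norm_mul, norm_pow]
  have s0 := summable_phi21Term (α := α) (β := β) hp hρ hz
  have s1 := summable_phi21Term (α := α) (β := β) hp hρ hpz
  have s2 := summable_phi21Term (α := α) (β := β) hp hρ hppz
  -- Replacing `z` by `pz` multiplies the `n`-th term by `p^n`, so this combination multiplies it by
  -- `(1 - p^n)(1 - ρ²p^n)`. That factor kills `n = 0` and cancels the new denominator at `n + 1`.
  have hL := (s0.hasSum.sub (s1.hasSum.mul_left (1 + ρ ^ 2))).add (s2.hasSum.mul_left (ρ ^ 2))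
  have hR := ((s0.hasSum.sub (s1.hasSum.mul_left (α * ρ + β * ρ))).add
    (s2.hasSum.mul_left (α * ρ * (β * ρ)))).mul_left z
  have hL' := (hasSum_nat_add_iff' 1).2 hL
  have hterm (n : ℕ) : phi21Term (α * ρ) (β * ρ) (p * ρ ^ 2) p z (n + 1) -
          (1 + ρ ^ 2) * phi21Term (α * ρ) (β * ρ) (p * ρ ^ 2) p (p * z) (n + 1) +
        ρ ^ 2 * phi21Term (α * ρ) (β * ρ) (p * ρ ^ 2) p (p * (p * z)) (n + 1) =
      z * (phi21Term (α * ρ) (β * ρ) (p * ρ ^ 2) p z n -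
            (α * ρ + β * ρ) * phi21Term (α * ρ) (β * ρ) (p * ρ ^ 2) p (p * z) n +
          α * ρ * (β * ρ) * phi21Term (α * ρ) (β * ρ) (p * ρ ^ 2) p (p * (p * z)) n) := by
    simp only [phi21Term_mul_pow]
    rw [phi21Term_succ]
    have h1 := one_sub_mul_pow_ne_zero hp hp n
    have h2 := one_sub_mul_pow_ne_zero hρ' hp n
    generalize phi21Term (α * ρ) (β * ρ) (p * ρ ^ 2) p z n = t
    have e : (1 - α * ρ * p ^ n) * (1 - β * ρ * p ^ n) /
        ((1 - p * p ^ n) * (1 - p * ρ ^ 2 * p ^ n)) * ((1 - p * p ^ n) * (1 - p * ρ ^ 2 * p ^ n)) =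
        (1 - α * ρ * p ^ n) * (1 - β * ρ * p ^ n) := div_mul_cancel₀ _ (mul_ne_zero h1 h2)
    linear_combination (z * t) * e
  have key := hL'.unique (hR.congr_fun hterm)
  simp only [Finset.sum_range_one, phi21Term_zero] at key
  unfold phi21
  linear_combination key

/-! ### Infinite products and asymptotics of first-order recurrences. -/

lemma exists_ne_zero_tendsto_prod_one_sub {u : ℕ → ℂ} (hu : Summable fun k => ‖u k‖)
    (h1 : ∀ k, 1 - u k ≠ 0) :
    ∃ Q : ℂ, Q ≠ 0 ∧ Tendsto (fun n => ∏ j ∈ Finset.range n, (1 - u j)) atTop (𝓝 Q) := by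
  have hu' : Summable fun k => ‖-u k‖ := by simpa using hu
  refine ⟨∏' j, (1 + -u j),
    tprod_one_add_ne_zero_of_summable (fun k => by simpa [← sub_eq_add_neg] using h1 k) hu', ?_⟩
  simpa [← sub_eq_add_neg] using (multipliable_one_add_of_summable hu').tendsto_prod_tprod_nat

lemma tendsto_zero_of_affine_recurrence {w δ : ℕ → ℂ} {r : ℂ} (hr : ‖r‖ < 1)
    (hδ : Tendsto δ atTop (𝓝 0)) (hw : ∀ k, w (k + 1) = δ k + r * w k) :
    Tendsto w atTop (𝓝 0) := by
  rw [Metric.tendsto_atTop]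
  intro ε hε
  -- This threshold makes `ε / 2` a fixed point of `t ↦ ε / 2 * (1 - ‖r‖) + ‖r‖ * t`.
  have hδ' := (tendsto_zero_iff_norm_tendsto_zero.1 hδ).eventually_le_const
    (show 0 < ε / 2 * (1 - ‖r‖) by have := sub_pos.2 hr; positivity)
  obtain ⟨K, hK⟩ := eventually_atTop.1 hδ'
  have hb (n : ℕ) : ‖w (K + n)‖ ≤ ε / 2 + ‖r‖ ^ n * ‖w K‖ := by
    induction n with
    | zero => simpa using (half_pos hε).le
    | succ n ih =>
      rw [← add_assoc, hw]
      refine (norm_add_le _ _).trans ?_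
      rw [norm_mul]
      have := hK (K + n) (by omega)
      have := mul_le_mul_of_nonneg_left ih (norm_nonneg r)
      rw [pow_succ]
      linarith
  have h0 : Tendsto (fun n : ℕ => ‖r‖ ^ n * ‖w K‖) atTop (𝓝 0) := by
    simpa using (tendsto_pow_atTop_nhds_zero_of_lt_one (norm_nonneg r) hr).mul_const ‖w K‖
  obtain ⟨L, hL⟩ := eventually_atTop.1 (h0.eventually_lt_const (half_pos hε))
  refine ⟨K + L, fun n hn => ?_⟩
  obtain ⟨m, rfl⟩ := Nat.exists_eq_add_of_le (show K ≤ n by omega)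
  rw [dist_zero_right]
  have := hb m
  have := hL m (by omega)
  linarith

/-- Solutions of `v_{k+1} = e_k + r v_k` with `e_k → e ≠ 0` dominate those of `d_{k+1} = r d_k`. -/
lemma tendsto_div_zero_of_affine_recurrence {v d e : ℕ → ℂ} {r l : ℂ} (hr : ‖r‖ < 1 ∨ r = 1)
    (he : Tendsto e atTop (𝓝 l)) (hl : l ≠ 0) (hv : ∀ k, v (k + 1) = e k + r * v k)
    (hd : ∀ k, d (k + 1) = r * d k) :
    (∀ᶠ k in atTop, v k ≠ 0) ∧ Tendsto (fun k => d k / v k) atTop (𝓝 0) := by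
  rcases hr with hr | rfl
  · have h1 : 1 - r ≠ 0 := by
      rintro h
      rw [← sub_eq_zero.1 h, norm_one] at hr
      exact lt_irrefl _ hr
    have hlim : Tendsto v atTop (𝓝 (l / (1 - r))) := by
      rw [← tendsto_sub_nhds_zero_iff]
      refine tendsto_zero_of_affine_recurrence hr (tendsto_sub_nhds_zero_iff.2 he) fun k => ?_
      rw [hv]
      field_simp
      ring
    have hd0 : Tendsto d atTop (𝓝 0) :=
      tendsto_zero_of_affine_recurrence (δ := fun _ => 0) hr tendsto_const_nhds (by simpa using hd)
    have hne : l / (1 - r) ≠ 0 := div_ne_zero hl h1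
    exact ⟨hlim.eventually_ne hne, by simpa [Pi.div_def] using hd0.div hlim hne⟩
  -- For `r = 1`, `v` is a partial sum of `e` and grows like `l n` by Cesàro, while `d` is constant.
  · have hvs (n : ℕ) : v n = v 0 + ∑ i ∈ Finset.range n, e i := by
      induction n with
      | zero => simp
      | succ n ih => rw [hv, ih, Finset.sum_range_succ]; ring
    have hds (n : ℕ) : d n = d 0 := by
      induction n with
      | zero => rfl
      | succ n ih => rw [hd, ih, one_mul]
    have hinv : Tendsto (fun n : ℕ => ((n : ℝ)⁻¹)) atTop (𝓝 0) := tendsto_inv_atTop_nhds_zero_nat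
    have hlim : Tendsto (fun n : ℕ => ((n : ℝ)⁻¹) • v n) atTop (𝓝 l) := by
      have := (hinv.smul_const (v 0)).add he.cesaro_smul
      rw [zero_smul, zero_add] at this
      exact this.congr fun n => by rw [hvs n, smul_add]
    have hdl : Tendsto (fun n : ℕ => ((n : ℝ)⁻¹) • d n) atTop (𝓝 0) := by
      have := hinv.smul_const (d 0)
      rw [zero_smul] at this
      exact this.congr fun n => by rw [hds n]
    refine ⟨(hlim.eventually_ne hl).mono fun k hk h => hk (by rw [h, smul_zero]), ?_⟩
    have := hdl.div hlim hl
    rw [zero_div] at this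
    refine this.congr' ?_
    filter_upwards [eventually_ne_atTop 0] with n hn
    simp only [Pi.div_apply, Complex.real_smul, Complex.ofReal_inv]
    rw [mul_div_mul_left _ _ (by simpa using hn)]

/-- If the Casoratians of `y` and `y'` with a minimal solution `f` are `C T_k` and `C' T_k`, then
`y'_k / y_k → C' / C`. -/
lemma tendsto_div_of_casoratian_of_ne_zero {y y' f u T : ℕ → ℂ} {r C C' τ : ℂ}
    (hr : ‖r‖ < 1 ∨ r = 1)
    (hf : Tendsto f atTop (𝓝 1)) (hf0 : ∀ k, f k ≠ 0)
    (hu : Summable fun k => ‖u k‖) (hu0 : ∀ k, 1 - u k ≠ 0)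
    (hT : Tendsto T atTop (𝓝 τ)) (hτ : τ ≠ 0) (hC : C ≠ 0)
    (hy : ∀ k, y (k + 1) * f (k + 1) - r * (1 - u (k + 1)) * f (k + 2) * y k = C * T k)
    (hy' : ∀ k, y' (k + 1) * f (k + 1) - r * (1 - u (k + 1)) * f (k + 2) * y' k = C' * T k) :
    (∀ᶠ k in atTop, y k ≠ 0) ∧ Tendsto (fun k => y' k / y k) atTop (𝓝 (C' / C)) := by
  obtain ⟨Q, hQ, hlim⟩ := exists_ne_zero_tendsto_prod_one_sub hu hu0
  set q : ℕ → ℂ := fun n => ∏ j ∈ Finset.range n, (1 - u j) with hq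
  have hq0 (n : ℕ) : q n ≠ 0 := Finset.prod_ne_zero_iff.2 fun j _ => hu0 j
  have hqs (n : ℕ) : q (n + 1) = q n * (1 - u n) := Finset.prod_range_succ _ _
  have he : Tendsto (fun k => C * T k / (f (k + 1) * f (k + 2) * q (k + 2))) atTop
      (𝓝 (C * τ / (1 * 1 * Q))) := by
    refine (hT.const_mul C).div (((hf.comp (tendsto_add_atTop_nat 1)).mul
      (hf.comp (tendsto_add_atTop_nat 2))).mul (hlim.comp (tendsto_add_atTop_nat 2))) ?_
    simpa using hQ
  -- Since `q (k + 2)` contains the factor `1 - u (k + 1)`, this normalisation leaves the constant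
  -- ratio `r`. In `y' - (C'/C) y` the inhomogeneous terms cancel.
  obtain ⟨h1, h2⟩ := tendsto_div_zero_of_affine_recurrence
    (v := fun k => y k / (f (k + 1) * q (k + 1)))
    (d := fun k => (y' k - C' / C * y k) / (f (k + 1) * q (k + 1))) hr he
    (div_ne_zero (mul_ne_zero hC hτ) (by simpa using hQ)) (fun k => by
      have := hf0 (k + 1); have := hf0 (k + 2); have := hq0 (k + 1); have := hu0 (k + 1)
      rw [← hy k, hqs (k + 1)]
      field_simp
      ring) (fun k => by
      have := hf0 (k + 1); have := hf0 (k + 2); have := hq0 (k + 1); have := hu0 (k + 1)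
      have e : (y' (k + 1) - C' / C * y (k + 1)) * f (k + 1) =
          r * (1 - u (k + 1)) * f (k + 2) * (y' k - C' / C * y k) := by
        have h : C' / C * C = C' := div_mul_cancel₀ _ hC
        linear_combination hy' k - C' / C * hy k - T k * h
      rw [hqs (k + 1), div_eq_iff (by positivity), ← mul_right_inj' (hf0 (k + 1))]
      generalize y' (k + 1) - C' / C * y (k + 1) = s at *
      generalize y' k - C' / C * y k = t at *
      field_simp
      linear_combination e)
  have hne : ∀ᶠ k in atTop, y k ≠ 0 := h1.mono fun k hk h => hk (by simp [h])
  refine ⟨hne, ?_⟩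
  have h3 := h2.const_add (C' / C)
  rw [add_zero] at h3
  refine h3.congr' ?_
  filter_upwards [hne] with k hk
  have hfq := mul_ne_zero (hf0 (k + 1)) (hq0 (k + 1))
  rw [div_div_div_cancel_right₀ hfq]
  field_simp
  ring

/-- Both `f` and `1 - u` tend to `1`, so a shift of the index makes them nowhere zero. -/
lemma tendsto_div_of_casoratian {y y' f u T : ℕ → ℂ} {r C C' τ : ℂ}
    (hr : ‖r‖ < 1 ∨ r = 1)
    (hf : Tendsto f atTop (𝓝 1)) (hu : Summable fun k => ‖u k‖)
    (hT : Tendsto T atTop (𝓝 τ)) (hτ : τ ≠ 0) (hC : C ≠ 0)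
    (hy : ∀ k, y (k + 1) * f (k + 1) - r * (1 - u (k + 1)) * f (k + 2) * y k = C * T k)
    (hy' : ∀ k, y' (k + 1) * f (k + 1) - r * (1 - u (k + 1)) * f (k + 2) * y' k = C' * T k) :
    (∀ᶠ k in atTop, y k ≠ 0) ∧ Tendsto (fun k => y' k / y k) atTop (𝓝 (C' / C)) := by
  have hu1 : Tendsto (fun k => 1 - u k) atTop (𝓝 1) := by
    simpa using (tendsto_zero_iff_norm_tendsto_zero.2 hu.tendsto_atTop_zero).const_sub 1
  obtain ⟨M, hM⟩ := eventually_atTop.1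
    ((hf.eventually_ne one_ne_zero).and (hu1.eventually_ne one_ne_zero))
  obtain ⟨h1, h2⟩ := tendsto_div_of_casoratian_of_ne_zero (y := fun k => y (k + M))
    (y' := fun k => y' (k + M)) (f := fun k => f (k + M)) (u := fun k => u (k + M))
    (T := fun k => T (k + M)) (C := C) (C' := C') hr
    (hf.comp (tendsto_add_atTop_nat M)) (fun k => (hM (k + M) (by omega)).1)
    ((summable_nat_add_iff (f := fun k => ‖u k‖) M).2 hu) (fun k => (hM (k + M) (by omega)).2)
    (hT.comp (tendsto_add_atTop_nat M)) hτ hC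
    (fun k => by simpa only [add_right_comm] using hy (k + M))
    (fun k => by simpa only [add_right_comm] using hy' (k + M))
  refine ⟨?_, (tendsto_add_atTop_iff_nat (f := fun k => y' k / y k) M).1 h2⟩
  obtain ⟨L, hL⟩ := eventually_atTop.1 h1
  refine eventually_atTop.2 ⟨L + M, fun k hk => ?_⟩
  have := hL (k - M) (by omega)
  rwa [Nat.sub_add_cancel (by omega)] at this

/-! ### Finiteness of zero sets, and nonvanishing at `ρ = 0`. -/

lemma finite_zeros_closedBall {h : ℂ → ℂ} {R : ℝ} (hR : 1 < R)
    (hd : DifferentiableOn ℂ h (Metric.ball 0 R)) (h0 : h 0 ≠ 0) :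
    {ρ : ℂ | ‖ρ‖ ≤ 1 ∧ h ρ = 0}.Finite := by
  have ha := hd.analyticOnNhd Metric.isOpen_ball
  rcases ha.eqOn_zero_or_eventually_ne_zero_of_preconnected
    (convex_ball (0 : ℂ) R).isPreconnected with hz | hz
  · exact absurd (hz (Metric.mem_ball_self (by linarith))) h0
  · have hmem : {x | h x ≠ 0} ∈ codiscreteWithin (Metric.closedBall (0 : ℂ) 1) :=
      codiscreteWithin_mono (Metric.closedBall_subset_ball hR) hz
    refine ((isCompact_closedBall (0 : ℂ) 1).finite_sdiff_of_mem_codiscreteWithin hmem).subset ?_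
    rintro ρ ⟨h1, h2⟩
    exact ⟨by simpa using h1, by simpa using h2⟩

/-- At `ρ = 0` the `q`-difference equation reads `(1 - z) φ(z) = φ(pz)`. A zero at `z` would
propagate to every `p^k z`, against `φ → 1` at the origin. -/
lemma phi21_zero_ne_zero {p z : ℂ} (hp : ‖p‖ < 1) (hz : ‖z‖ < 1) :
    phi21 0 0 0 p z ≠ 0 := by
  intro h0
  have hpk (k : ℕ) : ‖p ^ k * z‖ < 1 := by
    rw [norm_mul, norm_pow, mul_comm]
    exact mul_pow_lt_one (norm_nonneg _) hz (norm_nonneg _) hp k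
  have hk (k : ℕ) : phi21 0 0 0 p (p ^ k * z) = 0 := by
    induction k with
    | zero => simpa using h0
    | succ k ih =>
      have := phi21_qDifference (α := 0) (β := 0) (ρ := 0) hp (by simp) (hpk k)
      simp only [mul_zero, ne_eq, OfNat.ofNat_ne_zero, not_false_eq_true, zero_pow, add_zero,
        sub_zero, zero_mul, one_mul, ih] at this
      rw [pow_succ', mul_assoc, ← this]
  have hlim : Tendsto (fun k : ℕ => p ^ k * z) atTop (𝓝 0) := by
    simpa using (tendsto_pow_atTop_nhds_zero_of_norm_lt_one hp).mul_const z
  have := tendsto_phi21_one (α := 0) (β := 0) (ρ := 0) hp (by simp) hlim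
  simp only [mul_zero, ne_eq, OfNat.ofNat_ne_zero, not_false_eq_true, zero_pow, hk] at this
  exact zero_ne_one (tendsto_nhds_unique tendsto_const_nhds this)

/-! ### The series along the geometric sequence of arguments. -/

/-- The argument `b q ^ (2k-1) / a`. -/
noncomputable def qArg (a b : ℝ) (q : ℂ) (k : ℕ) : ℂ := (b : ℂ) / ((a : ℂ) * q) * (q ^ 2) ^ k

lemma qArg_succ (a b : ℝ) (q : ℂ) (k : ℕ) : qArg a b q (k + 1) = q ^ 2 * qArg a b q k := by
  simp only [qArg, pow_succ]
  ring

lemma norm_sq_lt_one {q : ℂ} (hq1 : ‖q‖ < 1) : ‖q ^ 2‖ < 1 := by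
  rw [norm_pow]
  exact pow_lt_one₀ (norm_nonneg _) hq1 two_ne_zero

lemma summable_norm_qArg (a b : ℝ) {q : ℂ} (hq1 : ‖q‖ < 1) : Summable fun k => ‖qArg a b q k‖ := by
  simp only [qArg, norm_mul, norm_pow]
  refine (summable_geometric_of_lt_one (by positivity) ?_).mul_left _
  simpa using norm_sq_lt_one hq1

lemma tendsto_qArg (a b : ℝ) {q : ℂ} (hq1 : ‖q‖ < 1) : Tendsto (qArg a b q) atTop (𝓝 0) :=
  tendsto_zero_iff_norm_tendsto_zero.2 (summable_norm_qArg a b hq1).tendsto_atTop_zero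

lemma norm_qArg_add_lt_one {a b : ℝ} {q : ℂ} {N : ℕ} (hq1 : ‖q‖ < 1) (hN : ‖qArg a b q N‖ < 1)
    (k : ℕ) : ‖qArg a b q (N + k)‖ < 1 := by
  rw [qArg, pow_add, ← mul_assoc, norm_mul, norm_pow (q ^ 2) k]
  exact mul_pow_lt_one (norm_nonneg _) hN (norm_nonneg _) (norm_sq_lt_one hq1) k

lemma betaCoeff_eq {a b : ℝ} {q : ℂ} (hq : q ≠ 0) (k : ℕ) :
    betaCoeff a b q k = 1 / 4 * (1 - qArg a b q k) * (1 - qArg b a q k) := by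
  have h : q ^ (2 * (k : ℤ) - 1) = (q ^ 2) ^ k / q := by
    rw [zpow_sub₀ hq, zpow_one, zpow_mul, zpow_natCast]
    norm_cast
  rw [betaCoeff, h, qArg, qArg]
  congr 2 <;> ring

lemma one_le_cConst_sq {a b : ℝ} (hab : a * b < 0) : 1 ≤ cConst a b ^ 2 := by
  have hs : 0 < -(a * b) := by linarith
  rw [cConst, div_pow, mul_pow, Real.sq_sqrt hs.le, le_div_iff₀ (by positivity)]
  nlinarith [sq_nonneg (1 + a * b)]

/-- With `two_gamma_mul`, this matches the coefficients of the `q`-difference equation to `α_k` and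
to one factor of `β_k`: `2γ₁` and `2γ₂` have sum `2aqc/b` and product `(aq/b)²`. -/
lemma two_gamma_add {a b : ℝ} {q : ℂ} (hab : a * b < 0) (hq : q ≠ 0) (k : ℕ) :
    (2 * gammaOne a b q + 2 * gammaTwo a b q) * qArg a b q k =
      2 * (cConst a b : ℂ) * (q ^ 2) ^ k := by
  have ha : (a : ℂ) ≠ 0 := by rintro h; simp_all
  have hb : (b : ℂ) ≠ 0 := by rintro h; simp_all
  simp only [gammaOne, gammaTwo, qArg]
  push_cast
  field_simp
  ring

lemma two_gamma_mul {a b : ℝ} {q : ℂ} (hab : a * b < 0) (hq : q ≠ 0) (k : ℕ) :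
    2 * gammaOne a b q * (2 * gammaTwo a b q) * qArg a b q k = qArg b a q (k + 1) := by
  have ha : (a : ℂ) ≠ 0 := by rintro h; simp_all
  have hb : (b : ℂ) ≠ 0 := by rintro h; simp_all
  have hs : ((Real.sqrt (cConst a b ^ 2 - 1) : ℝ) : ℂ) ^ 2 = (cConst a b : ℂ) ^ 2 - 1 := by
    rw [← Complex.ofReal_pow, Real.sq_sqrt (by linarith [one_le_cConst_sq hab])]
    push_cast
    ring
  simp only [gammaOne, gammaTwo, qArg, pow_succ (q ^ 2) k]
  push_cast
  field_simp
  linear_combination -hs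

/-- `₂φ₁ (2γ₁ρ, 2γ₂ρ; q²ρ²; q², b q ^ (2k-1) / a)`. -/
noncomputable def phiShift (a b : ℝ) (q ρ : ℂ) (k : ℕ) : ℂ :=
  phi21 (2 * gammaOne a b q * ρ) (2 * gammaTwo a b q * ρ) (q ^ 2 * ρ ^ 2) (q ^ 2) (qArg a b q k)

lemma phiShift_recurrence {a b : ℝ} {q ρ : ℂ} (hab : a * b < 0) (hq : q ≠ 0) (hq1 : ‖q‖ < 1)
    (hρ : ‖q ^ 2‖ * ‖ρ‖ ^ 2 < 1) {k : ℕ} (hk : ‖qArg a b q k‖ < 1) :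
    (1 - qArg a b q k) * phiShift a b q ρ k =
      (1 + ρ ^ 2 - 2 * cConst a b * ρ * (q ^ 2) ^ k) * phiShift a b q ρ (k + 1) -
      ρ ^ 2 * (1 - qArg b a q (k + 1)) * phiShift a b q ρ (k + 2) := by
  have h := phi21_qDifference (α := 2 * gammaOne a b q) (β := 2 * gammaTwo a b q)
    (norm_sq_lt_one hq1) hρ hk
  simp only [phiShift, qArg_succ a b q]
  rw [h]
  have h1 := two_gamma_add hab hq k
  have h2 := two_gamma_mul hab hq k
  generalize phi21 _ _ _ _ (q ^ 2 * qArg a b q k) = s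
  generalize phi21 _ _ _ _ (q ^ 2 * (q ^ 2 * qArg a b q k)) = t
  linear_combination -(ρ * s) * h1 + (ρ ^ 2 * t) * h2

lemma tendsto_phiShift {a b : ℝ} {q ρ : ℂ} (hq1 : ‖q‖ < 1) (hρ : ‖q ^ 2‖ * ‖ρ‖ ^ 2 < 1) :
    Tendsto (phiShift a b q ρ) atTop (𝓝 1) :=
  tendsto_phi21_one (norm_sq_lt_one hq1) hρ (tendsto_qArg a b hq1)

/-! ### The scaled recurrence and its Casoratian. -/

/-- The recurrence of the polynomials `P_k`, rewritten for `(2ρ) ^ k P_k` with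
`x = (ρ + ρ⁻¹) / 2`. -/
def IsScaledSolution (a b : ℝ) (q ρ : ℂ) (y : ℕ → ℂ) : Prop :=
  ∀ k, y (k + 2) = (1 + ρ ^ 2 - 2 * cConst a b * ρ * (q ^ 2) ^ (k + 1)) * y (k + 1) -
    ρ ^ 2 * (1 - qArg a b q (k + 1)) * (1 - qArg b a q (k + 1)) * y k

/-- The Casoratian of a solution `y` and the minimal solution given by `phiShift`. -/
noncomputable def casoratian (a b : ℝ) (q ρ : ℂ) (y : ℕ → ℂ) (k : ℕ) : ℂ :=
  y (k + 1) * phiShift a b q ρ (k + 1) -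
    ρ ^ 2 * (1 - qArg b a q (k + 1)) * phiShift a b q ρ (k + 2) * y k

/-- The minimal solution is `ρ^(2k) ∏_{1≤j≤k} (1 - qArg b a q j)` times `phiShift` at `k + 1`.
`casoratian` omits this prefactor, which may vanish, so in Abel's identity only the factor `1 - qArg
a b q` of the last coefficient survives. -/
lemma casoratian_add {a b : ℝ} {q ρ : ℂ} {y : ℕ → ℂ} {N : ℕ} (hab : a * b < 0) (hq : q ≠ 0)
    (hq1 : ‖q‖ < 1) (hρ : ‖q ^ 2‖ * ‖ρ‖ ^ 2 < 1) (hN : ‖qArg a b q N‖ < 1)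
    (hy : IsScaledSolution a b q ρ y) (k : ℕ) :
    casoratian a b q ρ y (N + k) =
      casoratian a b q ρ y N * ∏ j ∈ Finset.range k, (1 - qArg a b q (N + (j + 1))) := by
  induction k with
  | zero => simp
  | succ k ih =>
    rw [Finset.prod_range_succ, ← mul_assoc, ← ih]
    have h := phiShift_recurrence hab hq hq1 hρ (norm_qArg_add_lt_one hq1 hN (k + 1))
    have h' := hy (N + k)
    simp only [casoratian, ← add_assoc] at h h' ⊢
    linear_combination (-y (N + k + 1)) * h + phiShift a b q ρ (N + k + 2) * h'

lemma tendsto_div_of_isScaledSolution {a b : ℝ} {q ρ : ℂ} {y y' : ℕ → ℂ} {N : ℕ}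
    (hab : a * b < 0) (hq : q ≠ 0) (hq1 : ‖q‖ < 1) (hρ : ‖ρ‖ < 1 ∨ ρ ^ 2 = 1)
    (hN : ‖qArg a b q N‖ < 1) (hy : IsScaledSolution a b q ρ y) (hy' : IsScaledSolution a b q ρ y')
    (h0 : casoratian a b q ρ y N ≠ 0) :
    (∀ᶠ k in atTop, y k ≠ 0) ∧ Tendsto (fun k => y' k / y k) atTop
      (𝓝 (casoratian a b q ρ y' N / casoratian a b q ρ y N)) := by
  have hq2 := norm_sq_lt_one hq1
  have hr : ‖ρ ^ 2‖ < 1 ∨ ρ ^ 2 = 1 := hρ.imp_left norm_sq_lt_one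
  have hρ1 : ‖ρ‖ ^ 2 ≤ 1 := by
    rw [← norm_pow]
    rcases hr with hr | hr
    · exact hr.le
    · simp [hr]
  have hρ2 : ‖q ^ 2‖ * ‖ρ‖ ^ 2 < 1 :=
    (mul_le_of_le_one_right (norm_nonneg _) hρ1).trans_lt hq2
  obtain ⟨τ, hτ, hT⟩ := exists_ne_zero_tendsto_prod_one_sub
    (u := fun j => qArg a b q (N + (j + 1)))
    (by
      have := (summable_nat_add_iff (N + 1)).2 (summable_norm_qArg a b hq1)
      refine this.congr fun j => ?_
      rw [show j + (N + 1) = N + (j + 1) by ring])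
    (fun j h => by
      have := norm_qArg_add_lt_one hq1 hN (j + 1)
      rw [← sub_eq_zero.1 h, norm_one] at this
      exact lt_irrefl _ this)
  have hcas (w : ℕ → ℂ) (hw : IsScaledSolution a b q ρ w) (k : ℕ) :=
    casoratian_add hab hq hq1 hρ2 hN hw k
  obtain ⟨h1, h2⟩ := tendsto_div_of_casoratian (y := fun k => y (k + N))
    (y' := fun k => y' (k + N)) (f := fun k => phiShift a b q ρ (k + N))
    (u := fun k => qArg b a q (k + N)) (C := casoratian a b q ρ y N)
    (C' := casoratian a b q ρ y' N) hr
    ((tendsto_phiShift hq1 hρ2).comp (tendsto_add_atTop_nat N))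
    ((summable_nat_add_iff N).2 (summable_norm_qArg b a hq1)) hT hτ h0
    (fun k => by
      simpa only [casoratian, add_right_comm, add_comm N] using hcas y hy k)
    (fun k => by
      simpa only [casoratian, add_right_comm, add_comm N] using hcas y' hy' k)
  refine ⟨?_, (tendsto_add_atTop_iff_nat (f := fun k => y' k / y k) N).1 h2⟩
  obtain ⟨L, hL⟩ := eventually_atTop.1 h1
  refine eventually_atTop.2 ⟨L + N, fun k hk => ?_⟩
  have := hL (k - N) (by omega)
  rwa [Nat.sub_add_cancel (by omega)] at this

/-! ### The convergents in terms of Casoratians. -/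

/-- The polynomials `(2ρ) ^ k P_k((ρ + ρ⁻¹) / 2)` in `ρ`. -/
noncomputable def scaledDenom (a b : ℝ) (q ρ : ℂ) : ℕ → ℂ
  | 0 => 1
  | 1 => 1 + ρ ^ 2 - 2 * cConst a b * ρ
  | (k + 2) => (1 + ρ ^ 2 - 2 * cConst a b * ρ * (q ^ 2) ^ (k + 1)) * scaledDenom a b q ρ (k + 1) -
      ρ ^ 2 * (1 - qArg a b q (k + 1)) * (1 - qArg b a q (k + 1)) * scaledDenom a b q ρ k

lemma isScaledSolution_scaledDenom (a b : ℝ) (q ρ : ℂ) :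
    IsScaledSolution a b q ρ (scaledDenom a b q ρ) := fun _ => rfl

/-- The value `ρ = 0` corresponds to `x = ∞`; there the Casoratian is seen not to vanish
identically. -/
lemma scaledDenom_zero_right (a b : ℝ) (q : ℂ) : ∀ k, scaledDenom a b q 0 k = 1
  | 0 => rfl
  | 1 => by simp [scaledDenom]
  | (k + 2) => by simp [scaledDenom, scaledDenom_zero_right a b q (k + 1)]

lemma differentiable_scaledDenom (a b : ℝ) (q : ℂ) :
    ∀ k, Differentiable ℂ fun ρ => scaledDenom a b q ρ k
  | 0 => by simp only [scaledDenom]; fun_prop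
  | 1 => by simp only [scaledDenom]; fun_prop
  | (k + 2) => by
    have h1 := differentiable_scaledDenom a b q k
    have h2 := differentiable_scaledDenom a b q (k + 1)
    simp only [scaledDenom]
    fun_prop

/-- A solution of the recurrence of the `P_k` at `x = (ρ + ρ⁻¹) / 2`, multiplied by `(2ρ) ^ k`,
solves the scaled recurrence. -/
lemma isScaledSolution_of_recurrence {a b : ℝ} {q ρ x : ℂ} {P : ℕ → Polynomial ℂ} (hq : q ≠ 0)
    (hρ : ρ ≠ 0) (hx : x = (ρ + ρ⁻¹) / 2)
    (hP : ∀ k, P (k + 2) = (Polynomial.X - Polynomial.C (alphaCoeff a b q (k + 1))) * P (k + 1) -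
        Polynomial.C (betaCoeff a b q (k + 1)) * P k) :
    IsScaledSolution a b q ρ fun k => (2 * ρ) ^ k * (P k).eval x := by
  intro k
  simp only [hP, Polynomial.eval_sub, Polynomial.eval_mul, Polynomial.eval_X, Polynomial.eval_C,
    betaCoeff_eq hq, alphaCoeff, pow_mul]
  have h : 2 * ρ * x = 1 + ρ ^ 2 := by
    rw [hx]
    field_simp
    ring
  linear_combination ((2 * ρ) ^ (k + 1) * (P (k + 1)).eval x) * h

lemma scaledDenom_eq {a b : ℝ} {q ρ x : ℂ} (hq : q ≠ 0) (hρ : ρ ≠ 0) (hx : x = (ρ + ρ⁻¹) / 2) :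
    ∀ k, scaledDenom a b q ρ k = (2 * ρ) ^ k * (denomPoly a b q k).eval x
  | 0 => by simp [scaledDenom, denomPoly]
  | 1 => by
    simp only [scaledDenom, denomPoly, hx, Polynomial.eval_sub, Polynomial.eval_X,
      Polynomial.eval_C]
    field_simp
    ring
  | (k + 2) => by
    have h := isScaledSolution_of_recurrence hq hρ hx
      (P := denomPoly a b q) (fun k => by rw [denomPoly]) k
    simp only at h
    rw [h, isScaledSolution_scaledDenom, scaledDenom_eq hq hρ hx k,
      scaledDenom_eq hq hρ hx (k + 1)]

lemma tendsto_convergent {a b : ℝ} {q ρ x : ℂ} {N : ℕ} (hab : a * b < 0) (hq : q ≠ 0)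
    (hq1 : ‖q‖ < 1) (hρ0 : ρ ≠ 0) (hρ : ‖ρ‖ < 1 ∨ ρ ^ 2 = 1) (hx : x = (ρ + ρ⁻¹) / 2)
    (hN : ‖qArg a b q N‖ < 1) (h0 : casoratian a b q ρ (scaledDenom a b q ρ) N ≠ 0) :
    (∀ᶠ k in atTop, (denomPoly a b q k).eval x ≠ 0) ∧
    Tendsto (fun k => convergent a b q x k) atTop
      (𝓝 (casoratian a b q ρ (fun k => (2 * ρ) ^ k * (numerPoly a b q k).eval x) N /
        casoratian a b q ρ (scaledDenom a b q ρ) N)) := by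
  obtain ⟨h1, h2⟩ := tendsto_div_of_isScaledSolution hab hq hq1 hρ hN
    (isScaledSolution_scaledDenom a b q ρ)
    (isScaledSolution_of_recurrence hq hρ0 hx (P := numerPoly a b q) fun k => by rw [numerPoly]) h0
  simp only [scaledDenom_eq hq hρ0 hx] at h1 h2
  refine ⟨h1.mono fun k hk => right_ne_zero_of_mul hk, h2.congr fun k => ?_⟩
  rw [convergent, mul_div_mul_left _ _ (pow_ne_zero _ (mul_ne_zero two_ne_zero hρ0))]

/-- The initial value `scaledDenom` at `1` is the middle coefficient of `phiShift_recurrence` at `k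
= 0`, so the Casoratian is the right side of that relation and `G` the left. -/
lemma casoratian_scaledDenom_zero {a b : ℝ} {q ρ : ℂ} (hab : a * b < 0) (hq : q ≠ 0)
    (hq1 : ‖q‖ < 1) (hρ : ‖q ^ 2‖ * ‖ρ‖ ^ 2 < 1) (h0 : ‖qArg a b q 0‖ < 1) :
    casoratian a b q ρ (scaledDenom a b q ρ) 0 = GSeries a b q ρ := by
  have h := phiShift_recurrence hab hq hq1 hρ h0
  have hz : qArg a b q 0 = (b : ℂ) / ((a : ℂ) * q) := by simp [qArg]
  have hG : GSeries a b q ρ = (1 - qArg a b q 0) * phiShift a b q ρ 0 := by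
    rw [GSeries, phiShift, hz]
  rw [hG, h]
  simp only [casoratian, scaledDenom]
  ring

lemma qArg_one {a b : ℝ} {q : ℂ} (hq : q ≠ 0) : qArg a b q 1 = (b : ℂ) * q / (a : ℂ) := by
  rw [qArg, pow_one, pow_two, div_mul_eq_mul_div, ← mul_assoc, mul_div_mul_right _ _ hq]

lemma casoratian_numerPoly_zero {a b : ℝ} {q ρ x : ℂ} (hq : q ≠ 0) :
    casoratian a b q ρ (fun k => (2 * ρ) ^ k * (numerPoly a b q k).eval x) 0 =
      2 * ρ * FSeries a b q ρ := by
  simp [casoratian, numerPoly, phiShift, FSeries, qArg_one hq]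

lemma finite_zeros_casoratian {a b : ℝ} {q : ℂ} {N : ℕ} (hq0 : 0 < ‖q‖) (hq1 : ‖q‖ < 1)
    (hN : ‖qArg a b q N‖ < 1) :
    {ρ : ℂ | ‖ρ‖ ≤ 1 ∧ casoratian a b q ρ (scaledDenom a b q ρ) N = 0}.Finite := by
  have hq2 := norm_sq_lt_one hq1
  -- Any `R` with `1 < R < 1/‖q‖` keeps the denominators `1 - q²ρ²q^(2j)` nonzero on the ball, which
  -- contains the closed unit disc.
  obtain ⟨R, hR1, hR⟩ := exists_between (one_lt_inv₀ hq0 |>.2 hq1)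
  have hqR : ‖q ^ 2‖ * R ^ 2 < 1 := by
    rw [norm_pow, ← mul_pow]
    refine pow_lt_one₀ (by positivity) ?_ two_ne_zero
    rwa [lt_inv_comm₀ (by positivity) hq0, ← one_div, lt_div_iff₀ (by positivity)] at hR
  refine finite_zeros_closedBall hR1 ?_ ?_
  · have hphi (k : ℕ) : DifferentiableOn ℂ (fun ρ => phiShift a b q ρ (N + k)) (Metric.ball 0 R) :=
      differentiableOn_phi21 hq2 hqR (norm_qArg_add_lt_one hq1 hN k)
    have h1 := hphi 1
    have h2 := hphi 2
    have h3 := (differentiable_scaledDenom a b q N).differentiableOn (s := Metric.ball 0 R)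
    have h4 := (differentiable_scaledDenom a b q (N + 1)).differentiableOn (s := Metric.ball 0 R)
    unfold casoratian
    fun_prop
  · have := phi21_zero_ne_zero hq2 (norm_qArg_add_lt_one hq1 hN 1)
    simpa [casoratian, scaledDenom_zero_right, phiShift] using this

/-! ### The choice of `ρ`. -/

lemma not_isUpper_of_isLower {x : ℂ} (h : IsLower x) : ¬ IsUpper x := by
  rintro h'
  rcases h with h | ⟨h1, h2⟩ <;> rcases h' with h' | ⟨h1', h2'⟩ <;> linarith

/-- A real `ϑ` would put `x` in `[-1, 1]`; otherwise replacing `ϑ` by `-ϑ` swaps the two norms. -/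
lemma exists_isAngle (x : ℂ) : ∃ ϑ, IsAngle x ϑ := by
  obtain ⟨ϑ, hϑ⟩ := Complex.cos_surjective x
  have hn (t : ℂ) : ‖Complex.exp (Complex.I * t)‖ = Real.exp (-t.im) := by
    simp [Complex.norm_exp]
  have hn' (t : ℂ) : ‖Complex.exp (-(Complex.I * t))‖ = Real.exp t.im := by
    simp [Complex.norm_exp]
  have him : IsUpper x ∨ IsLower x → ϑ.im ≠ 0 := by
    intro h h0
    have hr : x = ((Real.cos ϑ.re : ℝ) : ℂ) := by
      rw [← hϑ, Complex.ofReal_cos]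
      congr 1
      exact Complex.ext rfl (by simpa using h0)
    have h1 := Real.neg_one_le_cos ϑ.re
    have h2 := Real.cos_le_one ϑ.re
    have hre : x.re = Real.cos ϑ.re := by rw [hr, Complex.ofReal_re]
    have him : x.im = 0 := by rw [hr, Complex.ofReal_im]
    rcases h with (h | h) | (h | h)
    · linarith
    · linarith [h.2]
    · linarith
    · linarith [h.2]
  simp only [IsAngle, hn, hn', Real.exp_lt_exp]
  by_cases hU : IsUpper x
  · have hL : ¬ IsLower x := fun h => not_isUpper_of_isLower h hU
    rcases lt_or_gt_of_ne (him (Or.inl hU)) with h | h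
    · exact ⟨ϑ, hϑ, fun _ => by linarith, fun h => absurd h hL⟩
    · refine ⟨-ϑ, by rw [Complex.cos_neg, hϑ], fun _ => ?_, fun h => absurd h hL⟩
      rw [Complex.neg_im]
      linarith
  · by_cases hL : IsLower x
    · rcases lt_or_gt_of_ne (him (Or.inr hL)) with h | h
      · refine ⟨-ϑ, by rw [Complex.cos_neg, hϑ], fun h => absurd h hU, fun _ => ?_⟩
        rw [Complex.neg_im]
        linarith
      · exact ⟨ϑ, hϑ, fun h => absurd h hU, fun _ => by linarith⟩
    · exact ⟨ϑ, hϑ, fun h => absurd h hU, fun h => absurd h hL⟩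

lemma rho_spec {x ϑ : ℂ} (hx : x ∉ cutInterval) (hϑ : IsAngle x ϑ) :
    rho x ϑ ≠ 0 ∧ (‖rho x ϑ‖ < 1 ∨ rho x ϑ ^ 2 = 1) ∧ x = (rho x ϑ + (rho x ϑ)⁻¹) / 2 := by
  obtain ⟨hcos, hU, hL⟩ := hϑ
  have hn : ‖Complex.exp (-(Complex.I * ϑ))‖ * ‖Complex.exp (Complex.I * ϑ)‖ = 1 := by
    rw [← norm_mul, ← Complex.exp_add, neg_add_cancel, Complex.exp_zero, norm_one]
  have hc : x = (Complex.exp (Complex.I * ϑ) + Complex.exp (-(Complex.I * ϑ))) / 2 := by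
    rw [← hcos, Complex.cos, neg_mul, mul_comm]
  unfold rho
  split_ifs with h1 h2 h3
  · refine ⟨Complex.exp_ne_zero _, Or.inl ?_, ?_⟩
    · have := hU h1
      by_contra! h
      nlinarith
    · rw [Complex.exp_neg, inv_inv, ← Complex.exp_neg, add_comm]
      exact hc
  · refine ⟨Complex.exp_ne_zero _, Or.inl ?_, ?_⟩
    · have := hL h2
      by_contra! h
      nlinarith
    · rw [← Complex.exp_neg]
      exact hc
  · exact ⟨one_ne_zero, Or.inr (one_pow 2), by rw [h3]; norm_num⟩
  · refine ⟨by norm_num, Or.inr (by norm_num), ?_⟩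
    -- Off the cut, neither upper nor lower, and not `1`: only `x = -1` is left.
    simp only [_root_.IsUpper, _root_.IsLower, cutInterval, Set.mem_ofPred_eq, not_or, not_and, not_lt] at h1 h2 hx
    have him : x.im = 0 := le_antisymm h1.1 h2.1
    have hre : x.re = -1 := by
      by_contra hne
      have h4 := hx him (lt_of_le_of_ne (h2.2 him) (Ne.symm hne))
      exact h3 (Complex.ext (le_antisymm (h1.2 him) h4) him)
    rw [show x = -1 from Complex.ext (by simpa using hre) (by simpa using him)]
    norm_num

/-! ### Assembly. -/

theorem mainTheorem4 (a b : ℝ) (q : ℂ) (hab : a * b < 0) (hq0 : 0 < ‖q‖) (hq1 : ‖q‖ < 1) :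
    ∃ S : Set ℂ, S.Finite ∧ ∀ x : ℂ, x ∉ cutInterval → x ∉ S →
      (∀ᶠ k in atTop, (denomPoly a b q k).eval x ≠ 0) ∧
      (∃ X : ℂ, Tendsto (fun k => convergent a b q x k) atTop (𝓝 X)) ∧
      (‖(b : ℂ) / ((a : ℂ) * q)‖ < 1 →
        ∀ ϑ : ℂ, IsAngle x ϑ →
          Summable (fun k => seriesTerm a b q (rho x ϑ) ((b : ℂ) * q / (a : ℂ)) k) ∧
          Summable (fun k => seriesTerm a b q (rho x ϑ) ((b : ℂ) / ((a : ℂ) * q)) k) ∧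
          GSeries a b q (rho x ϑ) ≠ 0 ∧
          Tendsto (fun k => convergent a b q x k) atTop
            (𝓝 (2 * rho x ϑ * (FSeries a b q (rho x ϑ) / GSeries a b q (rho x ϑ))))) := by
  have hq : q ≠ 0 := norm_pos_iff.1 hq0
  have hq2 := norm_sq_lt_one hq1
  have hz0 : qArg a b q 0 = (b : ℂ) / ((a : ℂ) * q) := by simp [qArg]
  -- `N` depends only on `a`, `b`, `q`, hence so does `S`. It must be `0` when `|b/(aq)| < 1`, so
  -- that the same `S` excludes the zeros of `G`.
  obtain ⟨N, hN, hN0⟩ : ∃ N, ‖qArg a b q N‖ < 1 ∧ (‖qArg a b q 0‖ < 1 → N = 0) := by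
    by_cases h : ‖qArg a b q 0‖ < 1
    · exact ⟨0, h, fun _ => rfl⟩
    · obtain ⟨N, hN⟩ := ((summable_norm_qArg a b hq1).tendsto_atTop_zero.eventually_lt_const
        one_pos).exists
      exact ⟨N, hN, fun h' => absurd h' h⟩
  refine ⟨(fun ρ : ℂ => (ρ + ρ⁻¹) / 2) ''
    {ρ : ℂ | ‖ρ‖ ≤ 1 ∧ casoratian a b q ρ (scaledDenom a b q ρ) N = 0},
    (finite_zeros_casoratian hq0 hq1 hN).image _, fun x hx hxS => ?_⟩
  have hnorm (ϑ : ℂ) (hϑ : IsAngle x ϑ) : ‖rho x ϑ‖ ≤ 1 := by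
    rcases (rho_spec hx hϑ).2.1 with h | h
    · exact h.le
    · exact (pow_eq_one_iff_of_nonneg (norm_nonneg _) two_ne_zero).1
        (by rw [← norm_pow, h, norm_one]) |>.le
  have hcas (ϑ : ℂ) (hϑ : IsAngle x ϑ) :
      casoratian a b q (rho x ϑ) (scaledDenom a b q (rho x ϑ)) N ≠ 0 := fun h =>
    hxS ⟨rho x ϑ, ⟨hnorm ϑ hϑ, h⟩, (rho_spec hx hϑ).2.2.symm⟩
  have hlim (ϑ : ℂ) (hϑ : IsAngle x ϑ) := tendsto_convergent hab hq hq1 (rho_spec hx hϑ).1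
    (rho_spec hx hϑ).2.1 (rho_spec hx hϑ).2.2 hN (hcas ϑ hϑ)
  obtain ⟨ϑ₀, hϑ₀⟩ := exists_isAngle x
  refine ⟨(hlim ϑ₀ hϑ₀).1, ⟨_, (hlim ϑ₀ hϑ₀).2⟩, fun hz ϑ hϑ => ?_⟩
  rw [← hz0] at hz
  have hρ : ‖q ^ 2‖ * ‖rho x ϑ‖ ^ 2 < 1 :=
    (mul_le_of_le_one_right (norm_nonneg _)
      (pow_le_one₀ (norm_nonneg _) (hnorm ϑ hϑ))).trans_lt hq2
  have h1 := hcas ϑ hϑ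
  have h2 := (hlim ϑ hϑ).2
  obtain rfl := hN0 hz
  rw [casoratian_scaledDenom_zero hab hq hq1 hρ hz] at h1 h2
  rw [casoratian_numerPoly_zero hq, mul_div_assoc] at h2
  refine ⟨?_, ?_, h1, h2⟩
  · rw [← qArg_one hq]
    exact summable_phi21Term hq2 hρ (norm_qArg_add_lt_one hq1 hN 1)
  · rw [← hz0]
    exact summable_phi21Term hq2 hρ hz
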